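/- For each $n\ge 1$ let $(n_{11},n_{12},n_{21},n_{22})$ be the $2\times 2$ table of counts of a multinomial sample of size $n$ with fixed cell probabilities $(\pi_{11},\pi_{12},\pi_{21},\pi_{22})$, and let $\hat\pi_{ij}=n_{ij}/n$. Let $\tau\in[0,1]$ and $\lambda>0$, where $\lambda=\lambda_n$ may depend on $n$ (in particular it may be constant), and put $$\pi_{12}^*=\lambda\hat\pi_{12}+(1-\lambda)\tau,\qquad \pi_{21}^*=\lambda\hat\pi_{21}+(1-\lambda)\tau .$$ Assume the null hypothesis $H_0:\ \pi_{12}=\pi_{21}$, with $\pi_{12}>0$. Then the regularized McNemar statistic $$T^*=\frac{n}{\sqrt{n_{12}+n_{21}}}\cdot\frac{\pi_{12}^*-\pi_{21}^*}{\lambda}$$ is equal, for every $n\ge 1$, to the classical McNemar statistic $$T=\frac{n}{\sqrt{n_{12}+n_{21}}}\,(\hat\pi_{12}-\hat\pi_{21}),$$ and $T^*$ converges in distribution to $N(0,1)$ as $n\to\infty$. (Both statistics are given the value $0$ when $n_{12}+n_{21}=0$, an event whose probability tends to $0$.) -/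

import Mathlib

open MeasureTheory ProbabilityTheory Filter

/-- The multinomial distribution with `n` trials and cell probabilities `p`: the law of the
vector of cell counts of `n` independent draws from `p`. -/
noncomputable def multinomial {κ : Type*} [Fintype κ] [DecidableEq κ] [MeasurableSpace κ]
    (n : ℕ) (p : PMF κ) : Measure (κ → ℕ) :=
  (Measure.pi fun _ : Fin n => p.toMeasure).map
    fun x c => (Finset.univ.filter fun i => x i = c).card

/-- A table of counts with two rows and two columns. The cell in row `i`, column `j` of the
usual notation (`i, j = 1, 2`) has the index `(i - 1, j - 1)`, so that `k (0, 1)` is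
the count `n₁₂` and `k (1, 0)` is the count `n₂₁`. -/
abbrev CountTable := Fin 2 × Fin 2 → ℕ

namespace CountTable

/-- The maximum likelihood estimate `n_c / n` of the probability of the cell `c`. -/
noncomputable def mle (n : ℕ) (k : CountTable) (c : Fin 2 × Fin 2) : ℝ :=
  (k c : ℝ) / n

/-- The regularized estimate with target `τ` and weight `lam` of the maximum likelihood
estimate. -/
noncomputable def regEst (lam τ : ℝ) (n : ℕ) (k : CountTable) (c : Fin 2 × Fin 2) : ℝ :=
  lam * mle n k c + (1 - lam) * τ

/-- The classical McNemar statistic `n / √(n₁₂ + n₂₁) * (π̂₁₂ - π̂₂₁)`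
(with the value `0` if `n₁₂ + n₂₁ = 0`). -/
noncomputable def mcNemar (n : ℕ) (k : CountTable) : ℝ :=
  n / √((k (0, 1) : ℝ) + k (1, 0)) * (mle n k (0, 1) - mle n k (1, 0))

/-- The regularized McNemar statistic `n / √(n₁₂ + n₂₁) * (π*₁₂ - π*₂₁) / lam`
(with the value `0` if `n₁₂ + n₂₁ = 0`). -/
noncomputable def regMcNemar (lam τ : ℝ) (n : ℕ) (k : CountTable) : ℝ :=
  n / √((k (0, 1) : ℝ) + k (1, 0)) *
    ((regEst lam τ n k (0, 1) - regEst lam τ n k (1, 0)) / lam)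

end CountTable

/-! The target cancels in the difference of the two estimates and the weight cancels in the
quotient, so the regularized statistic is the classical one. The limit depends only on the laws of
the tables, so these may be taken as the counts of one i.i.d. sequence (`hasLaw_cellCounts`). There
`mcNemar_eq_mul` splits the statistic into a normalized sum of centred unit-variance terms, governed
by the central limit theorem, and a factor tending to one almost surely by the strong law. Slutsky's
theorem combines them. -/

/-- The table of the first `n` terms of a sequence: the number of times each value occurs. -/
def cellCounts {κ : Type*} [DecidableEq κ] (n : ℕ) (x : ℕ → κ) (c : κ) : ℕ :=
  (Finset.univ.filter fun i : Fin n => x i = c).card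

lemma cellCounts_eq_sum {κ : Type*} [DecidableEq κ] (n : ℕ) (x : ℕ → κ) (c : κ) :
    (cellCounts n x c : ℝ) = ∑ k ∈ Finset.range n, if x k = c then (1 : ℝ) else 0 := by
  rw [cellCounts, Finset.card_filter, Finset.sum_range]
  push_cast
  rfl

/-- The cell counts of the first `n` terms of an i.i.d. sequence have a multinomial law. -/
lemma hasLaw_cellCounts {κ : Type*} [Fintype κ] [DecidableEq κ] [MeasurableSpace κ]
    [DiscreteMeasurableSpace κ] (n : ℕ) (p : PMF κ) :
    HasLaw (cellCounts n) (multinomial n p) (Measure.infinitePi fun _ : ℕ => p.toMeasure) := by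
  have hlaw : HasLaw (fun (x : ℕ → κ) (i : Fin n) => x i)
      (Measure.pi fun _ : Fin n => p.toMeasure)
      (Measure.infinitePi fun _ : ℕ => p.toMeasure) := by
    refine iIndepFun.hasLaw_pi (X := fun (i : Fin n) (x : ℕ → κ) => x i)
      (fun i => (measurePreserving_eval_infinitePi (fun _ : ℕ => p.toMeasure) (i : ℕ)).hasLaw) ?_
    exact (iIndepFun_infinitePi (P := fun _ : ℕ => p.toMeasure)
      (X := fun _ x => x) (fun _ => measurable_id)).precomp Fin.val_injective
  have hcount : HasLaw
      (fun (x : Fin n → κ) (c : κ) => (Finset.univ.filter fun i => x i = c).card)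
      (multinomial n p) (Measure.pi fun _ : Fin n => p.toMeasure) :=
    ⟨Measurable.of_discrete.aemeasurable, rfl⟩
  exact hcount.comp hlaw

/-- The coordinates of an i.i.d. sequence, seen through a real function, are independent. -/
lemma iIndepFun_comp_eval {κ : Type*} [MeasurableSpace κ] [DiscreteMeasurableSpace κ]
    (p : PMF κ) (f : κ → ℝ) :
    iIndepFun (fun (k : ℕ) (x : ℕ → κ) => f (x k))
      (Measure.infinitePi fun _ : ℕ => p.toMeasure) :=
  iIndepFun_infinitePi (P := fun _ : ℕ => p.toMeasure) (X := fun _ => f)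
    (fun _ => Measurable.of_discrete)

lemma identDistrib_comp_eval {κ : Type*} [MeasurableSpace κ] [DiscreteMeasurableSpace κ]
    (p : PMF κ) (f : κ → ℝ) (k : ℕ) :
    IdentDistrib (fun x : ℕ → κ => f (x k)) (fun x => f (x 0))
      (Measure.infinitePi fun _ : ℕ => p.toMeasure)
      (Measure.infinitePi fun _ : ℕ => p.toMeasure) := by
  have hf : Measurable f := Measurable.of_discrete
  refine IdentDistrib.comp (u := f) (f := fun x : ℕ → κ => x k) (g := fun x : ℕ → κ => x 0)
    ⟨(measurable_pi_apply k).aemeasurable, (measurable_pi_apply 0).aemeasurable, ?_⟩ hf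
  rw [Measure.infinitePi_map_eval (fun _ : ℕ => p.toMeasure) k,
    Measure.infinitePi_map_eval (fun _ : ℕ => p.toMeasure) 0]

lemma integral_infinitePi_comp_eval {κ : Type*} [Fintype κ] [MeasurableSpace κ] [DiscreteMeasurableSpace κ]
    (p : PMF κ) (f : κ → ℝ) :
    ∫ x, f (x 0) ∂(Measure.infinitePi fun _ : ℕ => p.toMeasure) = ∑ c, (p c).toReal * f c := by
  have h := (measurePreserving_eval_infinitePi (fun _ : ℕ => p.toMeasure) 0).hasLaw.integral_comp
    (f := f) Measurable.of_discrete.aestronglyMeasurable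
  simpa [Function.comp_def, PMF.integral_eq_sum] using h

/-- The central limit theorem for a real function of i.i.d. draws from a finite set. -/
lemma tendstoInDistribution_inv_sqrt_mul_sum_comp_eval {κ : Type*} [Fintype κ]
    [MeasurableSpace κ] [DiscreteMeasurableSpace κ]
    {Ω' : Type*} [MeasurableSpace Ω'] {P' : Measure Ω'} [IsProbabilityMeasure P']
    (p : PMF κ) (f : κ → ℝ) (h0 : ∑ c, (p c).toReal * f c = 0)
    (h1 : ∑ c, (p c).toReal * f c ^ 2 = 1)
    {Ξ : Ω' → ℝ} (hΞ : HasLaw Ξ (gaussianReal 0 1) P') :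
    TendstoInDistribution
      (fun (n : ℕ) (x : ℕ → κ) => (√n)⁻¹ * ∑ k ∈ Finset.range n, f (x k)) atTop Ξ
      (fun _ => Measure.infinitePi fun _ : ℕ => p.toMeasure) P' := by
  refine tendstoInDistribution_inv_sqrt_mul_sum (X := fun (k : ℕ) (x : ℕ → κ) => f (x k)) hΞ
    ?_ ?_ (iIndepFun_comp_eval p f) (identDistrib_comp_eval p f)
  · rw [integral_infinitePi_comp_eval, h0]
  · simp only [Pi.pow_apply]
    rw [integral_infinitePi_comp_eval p fun c => f c ^ 2, h1]

/-- The strong law of large numbers for a real function of i.i.d. draws from a finite set. -/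
lemma ae_tendsto_sum_comp_eval_div {κ : Type*} [Fintype κ] [MeasurableSpace κ]
    [DiscreteMeasurableSpace κ] (p : PMF κ) (f : κ → ℝ) :
    ∀ᵐ x ∂(Measure.infinitePi fun _ : ℕ => p.toMeasure),
      Tendsto (fun n : ℕ => (∑ k ∈ Finset.range n, f (x k)) / n) atTop
        (nhds (∑ c, (p c).toReal * f c)) := by
  have hint : Integrable (fun x : ℕ → κ => f (x 0))
      (Measure.infinitePi fun _ : ℕ => p.toMeasure) :=
    ((measurePreserving_eval_infinitePi (fun _ : ℕ => p.toMeasure) 0).integrable_comp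
      Measurable.of_discrete.aestronglyMeasurable).2 Integrable.of_finite
  rw [← integral_infinitePi_comp_eval]
  exact strong_law_ae_real (fun k (x : ℕ → κ) => f (x k)) hint
    (fun i j hij => (iIndepFun_comp_eval p f).indepFun hij) (identDistrib_comp_eval p f)

/-- Slutsky's theorem for the self-normalized sums of i.i.d. draws from a finite set. -/
lemma tendstoInDistribution_inv_sqrt_mul_sum_mul_inv_sqrt_average {κ : Type*} [Fintype κ]
    [MeasurableSpace κ] [DiscreteMeasurableSpace κ]
    {Ω' : Type*} [MeasurableSpace Ω'] {P' : Measure Ω'} [IsProbabilityMeasure P']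
    (p : PMF κ) (f g : κ → ℝ) {v : ℝ} (hv : 0 < v) (hf : ∑ c, (p c).toReal * f c = 0)
    (hf2 : ∑ c, (p c).toReal * f c ^ 2 = 1) (hg : ∑ c, (p c).toReal * g c = v)
    {Ξ : Ω' → ℝ} (hΞ : HasLaw Ξ (gaussianReal 0 1) P') :
    TendstoInDistribution
      (fun (n : ℕ) (x : ℕ → κ) => (√n)⁻¹ * (∑ k ∈ Finset.range n, f (x k)) *
        (√v * (√((∑ k ∈ Finset.range n, g (x k)) / n))⁻¹)) atTop Ξ
      (fun _ => Measure.infinitePi fun _ : ℕ => p.toMeasure) P' := by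
  have hs : √v ≠ 0 := by positivity
  have hg_meas : Measurable g := Measurable.of_discrete
  have hmeas : ∀ n : ℕ, Measurable fun x : ℕ → κ =>
      √v * (√((∑ k ∈ Finset.range n, g (x k)) / n))⁻¹ := by
    intro n
    fun_prop
  have hfac : TendstoInMeasure (Measure.infinitePi fun _ : ℕ => p.toMeasure)
      (fun (n : ℕ) (x : ℕ → κ) => √v * (√((∑ k ∈ Finset.range n, g (x k)) / n))⁻¹)
      atTop (fun _ => 1) := by
    refine tendstoInMeasure_of_tendsto_ae (fun n => (hmeas n).aestronglyMeasurable) ?_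
    filter_upwards [ae_tendsto_sum_comp_eval_div p g] with x hx
    rw [hg] at hx
    -- The limit `1` is written as `√v * (√v)⁻¹`; inversion is continuous there because `v > 0`.
    rw [← mul_inv_cancel₀ hs]
    exact ((Real.continuous_sqrt.tendsto _).comp hx |>.inv₀ hs).const_mul _
  have hslutsky := (tendstoInDistribution_inv_sqrt_mul_sum_comp_eval p f hf hf2
    hΞ).continuous_comp_prodMk_of_tendstoInMeasure_const
    (g := fun z : ℝ × ℝ => z.1 * z.2) (by fun_prop) hfac fun n => (hmeas n).aemeasurable
  simpa only [mul_one] using hslutsky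

namespace CountTable

lemma regMcNemar_eq_mcNemar {lam : ℝ} (hlam : lam ≠ 0) (τ : ℝ) (n : ℕ) (k : CountTable) :
    regMcNemar lam τ n k = mcNemar n k := by
  rw [regMcNemar, mcNemar, regEst, regEst]
  congr 1
  field_simp
  ring

lemma regMcNemar_zero (lam τ : ℝ) (k : CountTable) : regMcNemar lam τ 0 k = mcNemar 0 k := by
  simp [regMcNemar, mcNemar]

/-- The McNemar statistic as a normalized sum times a factor that tends to one. -/
lemma mcNemar_eq_mul (n : ℕ) (k : CountTable) {s : ℝ} (hs : s ≠ 0) :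
    mcNemar n k = (√n)⁻¹ * (((k (0, 1) : ℝ) - k (1, 0)) / s) *
      (s * (√(((k (0, 1) : ℝ) + k (1, 0)) / n))⁻¹) := by
  rcases Nat.eq_zero_or_pos n with rfl | hn
  · simp [mcNemar]
  have hn' : (n : ℝ) ≠ 0 := by positivity
  have hsn : √(n : ℝ) ≠ 0 := by positivity
  rw [mcNemar, mle, mle, Real.sqrt_div' _ (Nat.cast_nonneg n)]
  field_simp

/-- The McNemar statistic of an i.i.d. sequence of draws is asymptotically standard normal under
the null hypothesis. -/
lemma tendstoInDistribution_mcNemar_cellCounts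
    {Ω' : Type*} [MeasurableSpace Ω'] {P' : Measure Ω'} [IsProbabilityMeasure P']
    (p : PMF (Fin 2 × Fin 2)) (hH0 : p (0, 1) = p (1, 0)) (hpos : 0 < p (0, 1))
    {Ξ : Ω' → ℝ} (hΞ : HasLaw Ξ (gaussianReal 0 1) P') :
    TendstoInDistribution (fun n x => mcNemar n (cellCounts n x)) atTop Ξ
      (fun _ => Measure.infinitePi fun _ : ℕ => p.toMeasure) P' := by
  set q : ℝ := (p (0, 1)).toReal with hq
  have hq' : (p (1, 0)).toReal = q := by rw [hq, hH0]
  have hq0 : 0 < q := ENNReal.toReal_pos hpos.ne' (p.apply_ne_top _)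
  have hs : √(2 * q) ≠ 0 := by positivity
  let d : Fin 2 × Fin 2 → ℝ := fun c =>
    ((if c = (0, 1) then 1 else 0) - (if c = (1, 0) then 1 else 0)) / √(2 * q)
  let e : Fin 2 × Fin 2 → ℝ := fun c =>
    (if c = (0, 1) then 1 else 0) + (if c = (1, 0) then 1 else 0)
  -- The null hypothesis makes the mean vanish.
  have hd1 : ∑ c, (p c).toReal * d c = 0 := by
    simp [d, Fintype.sum_prod_type, hq', ← hq]
    ring
  have he1 : ∑ c, (p c).toReal * e c = 2 * q := by
    simp [e, Fintype.sum_prod_type, hq', ← hq]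
    ring
  have hd2 : ∑ c, (p c).toReal * d c ^ 2 = 1 := by
    -- The two cells are disjoint, so the squared difference of their indicators is the sum of the
    -- indicators.
    have hde : ∀ c, d c ^ 2 = e c / (2 * q) := fun c => by
      simp only [d, e, div_pow, Real.sq_sqrt (by positivity : 0 ≤ 2 * q)]
      congr 1
      split_ifs <;> simp_all
    simp_rw [hde, ← mul_div_assoc]
    rw [← Finset.sum_div, he1, div_self (by positivity)]
  refine (tendstoInDistribution_inv_sqrt_mul_sum_mul_inv_sqrt_average p d e (by positivity)
    hd1 hd2 he1 hΞ).congr (fun n => ae_of_all _ fun x => ?_) (ae_of_all _ fun ω => rfl)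
  dsimp only
  rw [mcNemar_eq_mul n _ hs, cellCounts_eq_sum, cellCounts_eq_sum, ← Finset.sum_sub_distrib,
    ← Finset.sum_add_distrib, Finset.sum_div _ _ √(2 * q)]

end CountTable

/-- Convergence in distribution depends only on the laws. -/
lemma TendstoInDistribution.of_identDistrib {ι E Ω' : Type*} {Ω Ω₁ : ι → Type*}
    [∀ i, MeasurableSpace (Ω i)] [∀ i, MeasurableSpace (Ω₁ i)] [MeasurableSpace Ω']
    [TopologicalSpace E] [MeasurableSpace E] [OpensMeasurableSpace E]
    {μ : ∀ i, Measure (Ω i)} [∀ i, IsProbabilityMeasure (μ i)]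
    {ν : ∀ i, Measure (Ω₁ i)} [∀ i, IsProbabilityMeasure (ν i)]
    {μ' : Measure Ω'} [IsProbabilityMeasure μ']
    {X : ∀ i, Ω i → E} {Y : ∀ i, Ω₁ i → E} {Z : Ω' → E} {l : Filter ι}
    (h : TendstoInDistribution X l Z μ μ') (hXY : ∀ i, IdentDistrib (X i) (Y i) (μ i) (ν i)) :
    TendstoInDistribution Y l Z ν μ' where
  forall_aemeasurable i := (hXY i).aemeasurable_snd
  aemeasurable_limit := h.aemeasurable_limit
  tendsto := h.tendsto.congr fun i => Subtype.ext (hXY i).map_eq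

theorem theorem7
    {Ω : ℕ → Type*} [∀ n, MeasurableSpace (Ω n)]
    (P : ∀ n, Measure (Ω n)) [∀ n, IsProbabilityMeasure (P n)]
    {Ω' : Type*} [MeasurableSpace Ω'] (P' : Measure Ω') [IsProbabilityMeasure P']
    -- the cell probabilities, with the null hypothesis `π₁₂ = π₂₁` and `π₁₂ > 0`
    (p : PMF (Fin 2 × Fin 2)) (hH0 : p (0, 1) = p (1, 0)) (hpos : 0 < p (0, 1))
    -- for each `n`, the table of counts of a multinomial sample of size `n`
    (N : ∀ n, Ω n → CountTable) (hN : ∀ n, HasLaw (N n) (multinomial n p) (P n))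
    -- the shrinkage weight, which may depend on the sample size, and the target
    (lam : ℕ → ℝ) (hlam : ∀ n, 1 ≤ n → 0 < lam n)
    (τ : ℝ) (hτ : τ ∈ Set.Icc (0 : ℝ) 1)
    (Ξ : Ω' → ℝ) (hΞ : HasLaw Ξ (gaussianReal 0 1) P') :
    (∀ n, 1 ≤ n → ∀ ω,
      CountTable.regMcNemar (lam n) τ n (N n ω) = CountTable.mcNemar n (N n ω)) ∧
    TendstoInDistribution
      (fun n ω => CountTable.regMcNemar (lam n) τ n (N n ω)) atTop Ξ P P' := by
  have heq : ∀ n k, CountTable.regMcNemar (lam n) τ n k = CountTable.mcNemar n k := by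
    intro n k
    -- The weight is known to be positive only for `n ≥ 1`; at `n = 0` the prefactor `n` kills both
    -- statistics.
    rcases Nat.eq_zero_or_pos n with rfl | hn
    · exact CountTable.regMcNemar_zero _ _ _
    · exact CountTable.regMcNemar_eq_mcNemar (hlam n hn).ne' _ _ _
  refine ⟨fun n _ ω => heq n _, ?_⟩
  simp_rw [heq]
  -- The given tables may live on unrelated spaces, so the limit is transferred through equality of
  -- laws for each `n`.
  refine TendstoInDistribution.of_identDistrib
    (CountTable.tendstoInDistribution_mcNemar_cellCounts p hH0 hpos hΞ) fun n => ?_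
  have hlaw := hasLaw_cellCounts n p
  exact IdentDistrib.comp (u := CountTable.mcNemar n)
    ⟨hlaw.aemeasurable, (hN n).aemeasurable, hlaw.map_eq.trans (hN n).map_eq.symm⟩
    Measurable.of_discrete
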